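/- The following is a theorem of homotopy type theory (dependent type theory with $\Pi$, $\Sigma$, $+$, $0$, $1$, $\mathbb N$, identity types, a cumulative hierarchy of universes, function extensionality, univalence, propositional truncation $\|\cdot\|$ and nullification at arbitrary type families). All notions below are internal to that theory. Let $\mathcal U_i$ and $\mathcal U_j$ be universes, and let $T : I \to \mathcal U_i$ with $I : \mathcal U_j$ be a collection of types. For $X : \mathcal U_i$ write $X \in T$ for $\big\|\sum_{a:I} T(a) = X\big\|$. A type $X:\mathcal U_i$ is projective if for every type family $B : X \to \mathcal U_{\max(i,j)}$ with $\prod_{x:X}\|B(x)\|$ we have $\big\|\prod_{x:X} B(x)\big\|$. Suppose that $T$ is a projective presentation: $1 \in T$; if $X \in T$ and $B : X \to \mathcal U_i$ satisfies $B(x) \in T$ for all $x : X$, then $\sum_{x:X} B(x) \in T$; and every $X \in T$ is projective. Let $\bigcirc_T$ be the modality given by nullification at the family of propositions $a \mapsto \|T(a)\|$, $a : I$. **Lemma ($T$-local partial choice).** Let $X, C, D : \mathcal U_i$, let $f : X \to C$ be $T$-surjective, that is, $\bigcirc_T \|\mathrm{fib}_f(c)\|$ holds for all $c : C$, and let $g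 : D \to C$ be a map with $D$ projective. Then there merely exist a type $Z : \mathcal U_i$, a map $p : Z \to D$ that is a $T$-cover, that is, $\mathrm{fib}_p(d) \in T$ for all $d : D$, and a map $h : Z \to X$, such that $f(h(z)) = g(p(z))$ for all $z : Z$. -/

import Mathlib

/-!
Homotopy type theory as a formal system: dependent functions, a cumulative hierarchy of Russell
universes, and constants for all other types of the HoTT book, with function extensionality, the
univalence axiom, propositional truncation, and nullification at an arbitrary family of types.
A theorem of homotopy type theory is a closed type with a derivable closed term.
-/

namespace HoTT

/-- The constants. Numbers are universe levels: the first one is the level of the types involved,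
the second one, where present, the level of the type or family that one eliminates into. -/
inductive Cst : Type
  | empty | indEmpty (k : ℕ)
  | unit | star | indUnit (k : ℕ)
  | sum (i : ℕ) | inl (i : ℕ) | inr (i : ℕ) | indSum (i k : ℕ)
  | nat | zero | succ | indNat (k : ℕ)
  | sigma (i : ℕ) | pair (i : ℕ) | indSigma (i k : ℕ)
  | ident (i : ℕ) | refl (i : ℕ) | indIdent (i k : ℕ)
  | funext (i : ℕ) | univalence (i : ℕ)
  | trunc (i : ℕ) | truncIn (i : ℕ) | truncProp (i : ℕ) | truncRec (i k : ℕ)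
  | null (i : ℕ) | nullUnit (i : ℕ) | nullIsNull (i : ℕ) | nullRec (i k : ℕ)

/-- Raw terms with de Bruijn indices; types are terms. `pi` and `lam` bind the variable `0` of
their second argument. -/
inductive Tm : Type
  | var (n : ℕ)
  | univ (i : ℕ)
  | pi (A B : Tm)
  | lam (A b : Tm)
  | app (f a : Tm)
  | cst (c : Cst)

namespace Tm

/-- The renaming `r`, extended under one binder. -/
def upRen (r : ℕ → ℕ) : ℕ → ℕ
  | 0 => 0
  | n + 1 => r n + 1

def rename : (ℕ → ℕ) → Tm → Tm
  | r, var n => var (r n)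
  | _, univ i => univ i
  | r, pi A B => pi (rename r A) (rename (upRen r) B)
  | r, lam A b => lam (rename r A) (rename (upRen r) b)
  | r, app f a => app (rename r f) (rename r a)
  | _, cst c => cst c

/-- The substitution `s`, extended under one binder. -/
def up (s : ℕ → Tm) : ℕ → Tm
  | 0 => var 0
  | n + 1 => rename Nat.succ (s n)

def subst : (ℕ → Tm) → Tm → Tm
  | s, var n => s n
  | _, univ i => univ i
  | s, pi A B => pi (subst s A) (subst (up s) B)
  | s, lam A b => lam (subst s A) (subst (up s) b)
  | s, app f a => app (subst s f) (subst s a)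
  | _, cst c => cst c

/-- `b[a/0]`: substitute `a` for the variable `0` and lower all other variables by one. -/
def inst (b a : Tm) : Tm :=
  subst (fun n => match n with
    | 0 => a
    | n + 1 => var n) b

/-- A constant applied to a list of arguments. -/
def cstApp (c : Cst) (l : List Tm) : Tm := l.foldl app (cst c)

end Tm

/-! ### Writing terms with named bound variables

An `Exp` gives for every `n` a raw term to be placed under `n` binders. The variable bound by the
binder that has `n` binders above it gets, under `m` binders, the de Bruijn index `m - (n + 1)`. -/

abbrev Exp : Type := ℕ → Tm

/-- The closed raw term written by an expression. -/
def close (e : Exp) : Tm := e 0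

def bvar (n : ℕ) : Exp := fun m => Tm.var (m - (n + 1))

/-- The universe of level `i`. -/
def U (i : ℕ) : Exp := fun _ => Tm.univ i

/-- The dependent function type `∏ (x : A), B x`. -/
def pi (A : Exp) (B : Exp → Exp) : Exp := fun n => Tm.pi (A n) (B (bvar n) (n + 1))

/-- The abstraction `λ (x : A), b x`. -/
def lam (A : Exp) (b : Exp → Exp) : Exp := fun n => Tm.lam (A n) (b (bvar n) (n + 1))

def app (f a : Exp) : Exp := fun n => Tm.app (f n) (a n)

def const (c : Cst) : Exp := fun _ => Tm.cst c

def arrow (A B : Exp) : Exp := pi A fun _ => B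

infixl:90 " ⬝ " => app
infixr:60 " ⇒ " => arrow

/-! ### Basic types

In `sigma i A B`, `ident i A x y`, `trunc i A`, ..., the number `i` is the universe level at which
the type is formed. -/

def empty : Exp := const .empty
def unit : Exp := const .unit
def star : Exp := const .star
def sum (i : ℕ) (A B : Exp) : Exp := const (.sum i) ⬝ A ⬝ B
def nat : Exp := const .nat

/-- The dependent pair type `∑ (x : A), B x`. -/
def sigma (i : ℕ) (A : Exp) (B : Exp → Exp) : Exp := const (.sigma i) ⬝ A ⬝ lam A B

/-- The pair `(a, b) : ∑ (x : A), B x`. -/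
def pair (i : ℕ) (A : Exp) (B : Exp → Exp) (a b : Exp) : Exp :=
  const (.pair i) ⬝ A ⬝ lam A B ⬝ a ⬝ b

def prod (i : ℕ) (A B : Exp) : Exp := sigma i A fun _ => B

/-- The identity type `x =_A y`. -/
def ident (i : ℕ) (A x y : Exp) : Exp := const (.ident i) ⬝ A ⬝ x ⬝ y

def refl (i : ℕ) (A x : Exp) : Exp := const (.refl i) ⬝ A ⬝ x

/-- `A` is a mere proposition. -/
def isProp (i : ℕ) (A : Exp) : Exp := pi A fun x => pi A fun y => ident i A x y

/-- The propositional truncation `‖A‖`. -/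
def trunc (i : ℕ) (A : Exp) : Exp := const (.trunc i) ⬝ A

/-- The fibre `∑ (x : A), f x = y` of `f : A → B` over `y : B`. -/
def fib (i : ℕ) (A B f y : Exp) : Exp := sigma i A fun x => ident i B (f ⬝ x) y

/-! ### Equivalences -/

/-- `g : B → A` is a right inverse of `f : A → B`. -/
def isRightInv (i : ℕ) (B f g : Exp) : Exp := pi B fun y => ident i B (f ⬝ (g ⬝ y)) y

/-- `g : B → A` is a left inverse of `f : A → B`. -/
def isLeftInv (i : ℕ) (A f g : Exp) : Exp := pi A fun x => ident i A (g ⬝ (f ⬝ x)) x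

/-- `f : A → B` is an equivalence: it has a right inverse and a left inverse. -/
def isEquiv (i : ℕ) (A B f : Exp) : Exp :=
  prod i (sigma i (B ⇒ A) fun g => isRightInv i B f g)
    (sigma i (B ⇒ A) fun g => isLeftInv i A f g)

/-- The type `A ≃ B` of equivalences. -/
def equiv (i : ℕ) (A B : Exp) : Exp := sigma i (A ⇒ B) fun f => isEquiv i A B f

def idFun (A : Exp) : Exp := lam A fun x => x

/-- The identity equivalence of `A`. -/
def idEquiv (i : ℕ) (A : Exp) : Exp :=
  pair i (A ⇒ A) (fun f => isEquiv i A A f) (idFun A)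
    (pair i (sigma i (A ⇒ A) fun g => isRightInv i A (idFun A) g)
      (fun _ => sigma i (A ⇒ A) fun g => isLeftInv i A (idFun A) g)
      (pair i (A ⇒ A) (fun g => isRightInv i A (idFun A) g) (idFun A) (lam A fun x => refl i A x))
      (pair i (A ⇒ A) (fun g => isLeftInv i A (idFun A) g) (idFun A) (lam A fun x => refl i A x)))

/-- The function `(A =_U B) → (A ≃ B)`, by path induction. -/
def idToEquiv (i : ℕ) (A B : Exp) : Exp :=
  const (.indIdent (i + 1) i) ⬝ U i
    ⬝ (lam (U i) fun X => lam (U i) fun Y => lam (ident (i + 1) (U i) X Y) fun _ => equiv i X Y)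
    ⬝ (lam (U i) fun X => idEquiv i X)
    ⬝ A ⬝ B

/-- The function `(f = g) → ∏ (x : A), f x = g x`, by path induction; `B : A → U`. -/
def happly (i : ℕ) (A B f g : Exp) : Exp :=
  const (.indIdent i i) ⬝ (pi A fun x => B ⬝ x)
    ⬝ (lam (pi A fun x => B ⬝ x) fun f' => lam (pi A fun x => B ⬝ x) fun g' =>
        lam (ident i (pi A fun x => B ⬝ x) f' g') fun _ =>
          pi A fun x => ident i (B ⬝ x) (f' ⬝ x) (g' ⬝ x))
    ⬝ (lam (pi A fun x => B ⬝ x) fun f' => lam A fun x => refl i (B ⬝ x) (f' ⬝ x))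
    ⬝ f ⬝ g

/-! ### Nullification -/

/-- The nullification of `X` at the family `B : A → U`. -/
def null (i : ℕ) (A B X : Exp) : Exp := const (.null i) ⬝ A ⬝ B ⬝ X

/-- `Y` is `B`-null for `B : A → U_i`: for all `a : A` the diagonal map `Y → (B a → Y)` is an
equivalence. Here `Y` is of level `k`. -/
def isNull (i k : ℕ) (A B Y : Exp) : Exp :=
  pi A fun a => isEquiv (max i k) Y ((B ⬝ a) ⇒ Y) (lam Y fun y => lam (B ⬝ a) fun _ => y)

/-! ### The types of the constants -/

/-- The type of a constant. -/
def Cst.type : Cst → Exp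
  | .empty => U 0
  | .indEmpty k => pi (HoTT.empty ⇒ U k) fun P => pi HoTT.empty fun x => P ⬝ x
  | .unit => U 0
  | .star => HoTT.unit
  | .indUnit k =>
      pi (HoTT.unit ⇒ U k) fun P => (P ⬝ HoTT.star) ⇒ pi HoTT.unit fun x => P ⬝ x
  | .sum i => U i ⇒ U i ⇒ U i
  | .inl i => pi (U i) fun A => pi (U i) fun B => A ⇒ HoTT.sum i A B
  | .inr i => pi (U i) fun A => pi (U i) fun B => B ⇒ HoTT.sum i A B
  | .indSum i k =>
      pi (U i) fun A => pi (U i) fun B => pi (HoTT.sum i A B ⇒ U k) fun P =>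
        (pi A fun a => P ⬝ (const (.inl i) ⬝ A ⬝ B ⬝ a)) ⇒
        (pi B fun b => P ⬝ (const (.inr i) ⬝ A ⬝ B ⬝ b)) ⇒
        pi (HoTT.sum i A B) fun x => P ⬝ x
  | .nat => U 0
  | .zero => HoTT.nat
  | .succ => HoTT.nat ⇒ HoTT.nat
  | .indNat k =>
      pi (HoTT.nat ⇒ U k) fun P =>
        (P ⬝ const .zero) ⇒
        (pi HoTT.nat fun n => (P ⬝ n) ⇒ (P ⬝ (const .succ ⬝ n))) ⇒
        pi HoTT.nat fun n => P ⬝ n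
  | .sigma i => pi (U i) fun A => (A ⇒ U i) ⇒ U i
  | .pair i =>
      pi (U i) fun A => pi (A ⇒ U i) fun B => pi A fun a =>
        (B ⬝ a) ⇒ (const (.sigma i) ⬝ A ⬝ B)
  | .indSigma i k =>
      pi (U i) fun A => pi (A ⇒ U i) fun B => pi ((const (.sigma i) ⬝ A ⬝ B) ⇒ U k) fun P =>
        (pi A fun a => pi (B ⬝ a) fun b => P ⬝ (const (.pair i) ⬝ A ⬝ B ⬝ a ⬝ b)) ⇒
        pi (const (.sigma i) ⬝ A ⬝ B) fun p => P ⬝ p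
  | .ident i => pi (U i) fun A => A ⇒ A ⇒ U i
  | .refl i => pi (U i) fun A => pi A fun x => HoTT.ident i A x x
  | .indIdent i k =>
      pi (U i) fun A =>
        pi (pi A fun x => pi A fun y => HoTT.ident i A x y ⇒ U k) fun P =>
        (pi A fun x => P ⬝ x ⬝ x ⬝ HoTT.refl i A x) ⇒
        pi A fun x => pi A fun y => pi (HoTT.ident i A x y) fun p => P ⬝ x ⬝ y ⬝ p
  | .funext i =>
      pi (U i) fun A => pi (A ⇒ U i) fun B =>
        pi (pi A fun x => B ⬝ x) fun f => pi (pi A fun x => B ⬝ x) fun g =>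
        isEquiv i (HoTT.ident i (pi A fun x => B ⬝ x) f g)
          (pi A fun x => HoTT.ident i (B ⬝ x) (f ⬝ x) (g ⬝ x)) (happly i A B f g)
  | .univalence i =>
      pi (U i) fun A => pi (U i) fun B =>
        isEquiv (i + 1) (HoTT.ident (i + 1) (U i) A B) (equiv i A B) (idToEquiv i A B)
  | .trunc i => U i ⇒ U i
  | .truncIn i => pi (U i) fun A => A ⇒ HoTT.trunc i A
  | .truncProp i => pi (U i) fun A => isProp i (HoTT.trunc i A)
  | .truncRec i k =>
      pi (U i) fun A => pi (U k) fun B => isProp k B ⇒ (A ⇒ B) ⇒ HoTT.trunc i A ⇒ B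
  | .null i => pi (U i) fun A => (A ⇒ U i) ⇒ U i ⇒ U i
  | .nullUnit i =>
      pi (U i) fun A => pi (A ⇒ U i) fun B => pi (U i) fun X => X ⇒ HoTT.null i A B X
  | .nullIsNull i =>
      pi (U i) fun A => pi (A ⇒ U i) fun B => pi (U i) fun X =>
        isNull i i A B (HoTT.null i A B X)
  | .nullRec i k =>
      pi (U i) fun A => pi (A ⇒ U i) fun B => pi (U i) fun X => pi (U k) fun Y =>
        isNull i k A B Y ⇒
        isEquiv (max i k) (HoTT.null i A B X ⇒ Y) (X ⇒ Y)
          (lam (HoTT.null i A B X ⇒ Y) fun g => lam X fun x =>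
            g ⬝ (const (.nullUnit i) ⬝ A ⬝ B ⬝ X ⬝ x))

/-! ### The rules -/

open Tm in
/-- The computation rules of the eliminators. -/
inductive Comp : Tm → Tm → Prop
  | indUnit (k P c) : Comp (cstApp (.indUnit k) [P, c, cst .star]) c
  | indSumInl (i k A B P f g a) :
      Comp (cstApp (.indSum i k) [A, B, P, f, g, cstApp (.inl i) [A, B, a]]) (Tm.app f a)
  | indSumInr (i k A B P f g b) :
      Comp (cstApp (.indSum i k) [A, B, P, f, g, cstApp (.inr i) [A, B, b]]) (Tm.app g b)
  | indNatZero (k P c s) : Comp (cstApp (.indNat k) [P, c, s, cst .zero]) c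
  | indNatSucc (k P c s n) :
      Comp (cstApp (.indNat k) [P, c, s, cstApp .succ [n]])
        (Tm.app (Tm.app s n) (cstApp (.indNat k) [P, c, s, n]))
  | indSigma (i k A B P g a b) :
      Comp (cstApp (.indSigma i k) [A, B, P, g, cstApp (.pair i) [A, B, a, b]])
        (Tm.app (Tm.app g a) b)
  | indIdent (i k A P c x) :
      Comp (cstApp (.indIdent i k) [A, P, c, x, x, cstApp (.refl i) [A, x]]) (Tm.app c x)
  | truncRec (i k A B h f a) :
      Comp (cstApp (.truncRec i k) [A, B, h, f, cstApp (.truncIn i) [A, a]]) (Tm.app f a)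

/-- Judgments: `Γ` is a context; `a` is of type `A` in `Γ`; `a` and `b` are judgmentally equal
of type `A` in `Γ`. The head of the list `Γ` is the type of the variable `0`. -/
inductive Jdg : Type
  | isCtx (Γ : List Tm)
  | hasType (Γ : List Tm) (a A : Tm)
  | isEq (Γ : List Tm) (a b A : Tm)

open Jdg in
/-- Derivability. -/
inductive Derivable : Jdg → Prop
  -- contexts and variables
  | ctxNil : Derivable (isCtx [])
  | ctxCons {Γ A i} : Derivable (hasType Γ A (.univ i)) → Derivable (isCtx (A :: Γ))
  | var {Γ n A} : Derivable (isCtx Γ) → Γ[n]? = some A →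
      Derivable (hasType Γ (.var n) (A.rename (fun m => m + (n + 1))))
  -- judgmental equality
  | eqRefl {Γ a A} : Derivable (hasType Γ a A) → Derivable (isEq Γ a a A)
  | eqSymm {Γ a b A} : Derivable (isEq Γ a b A) → Derivable (isEq Γ b a A)
  | eqTrans {Γ a b c A} : Derivable (isEq Γ a b A) → Derivable (isEq Γ b c A) →
      Derivable (isEq Γ a c A)
  | conv {Γ a A B i} : Derivable (hasType Γ a A) → Derivable (isEq Γ A B (.univ i)) →
      Derivable (hasType Γ a B)
  | eqConv {Γ a b A B i} : Derivable (isEq Γ a b A) → Derivable (isEq Γ A B (.univ i)) →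
      Derivable (isEq Γ a b B)
  -- universes
  | univ {Γ i} : Derivable (isCtx Γ) → Derivable (hasType Γ (.univ i) (.univ (i + 1)))
  | cumul {Γ A i j} : Derivable (hasType Γ A (.univ i)) → i ≤ j →
      Derivable (hasType Γ A (.univ j))
  | eqCumul {Γ A B i j} : Derivable (isEq Γ A B (.univ i)) → i ≤ j →
      Derivable (isEq Γ A B (.univ j))
  -- dependent functions
  | pi {Γ A B i} : Derivable (hasType Γ A (.univ i)) → Derivable (hasType (A :: Γ) B (.univ i)) →
      Derivable (hasType Γ (.pi A B) (.univ i))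
  | lam {Γ A b B} : Derivable (hasType (A :: Γ) b B) →
      Derivable (hasType Γ (.lam A b) (.pi A B))
  | app {Γ A B f a} : Derivable (hasType Γ f (.pi A B)) → Derivable (hasType Γ a A) →
      Derivable (hasType Γ (.app f a) (B.inst a))
  | beta {Γ A B b a} : Derivable (hasType (A :: Γ) b B) → Derivable (hasType Γ a A) →
      Derivable (isEq Γ (.app (.lam A b) a) (b.inst a) (B.inst a))
  | eta {Γ A B f} : Derivable (hasType Γ f (.pi A B)) →
      Derivable (isEq Γ f (.lam A (.app (f.rename Nat.succ) (.var 0))) (.pi A B))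
  | eqPi {Γ A A' B B' i} : Derivable (hasType Γ A (.univ i)) →
      Derivable (isEq Γ A A' (.univ i)) → Derivable (isEq (A :: Γ) B B' (.univ i)) →
      Derivable (isEq Γ (.pi A B) (.pi A' B') (.univ i))
  | eqLam {Γ A A' b b' B i} : Derivable (hasType Γ A (.univ i)) →
      Derivable (isEq Γ A A' (.univ i)) → Derivable (isEq (A :: Γ) b b' B) →
      Derivable (isEq Γ (.lam A b) (.lam A' b') (.pi A B))
  | eqApp {Γ A B f f' a a'} : Derivable (isEq Γ f f' (.pi A B)) → Derivable (isEq Γ a a' A) →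
      Derivable (isEq Γ (.app f a) (.app f' a') (B.inst a))
  -- constants
  | cst {Γ} (c : Cst) : Derivable (isCtx Γ) → Derivable (hasType Γ (.cst c) (close c.type))
  | comp {Γ a b A} : Comp a b → Derivable (hasType Γ a A) → Derivable (hasType Γ b A) →
      Derivable (isEq Γ a b A)

/-- The closed type `A` is a theorem of homotopy type theory: it has a closed term. -/
def IsTheorem (A : Exp) : Prop := ∃ t : Tm, Derivable (.hasType [] t (close A))

/-! ### Collections of types, presentations, sheafification

A collection of types is a function `T : I → U_i` with `I : U_j`. It is small if `j ≤ i`. -/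

/-- `X ∈ T`: there merely is `a : I` with `T a = X`. -/
def mem (i j : ℕ) (I T X : Exp) : Exp :=
  trunc (max (i + 1) j) (sigma (max (i + 1) j) I fun a => ident (i + 1) (U i) (T ⬝ a) X)

/-- `T` is a presentation: `1 ∈ T`, and `T` is closed under dependent sums. -/
def isPresentation (i j : ℕ) (I T : Exp) : Exp :=
  prod (max (i + 1) j) (mem i j I T unit)
    (pi (U i) fun X => pi (X ⇒ U i) fun B =>
      mem i j I T X ⇒ (pi X fun x => mem i j I T (B ⬝ x)) ⇒
        mem i j I T (sigma i X fun x => B ⬝ x))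

/-- `X` is projective with respect to type families in the universe of level `k`. -/
def isProjective (k : ℕ) (X : Exp) : Exp :=
  pi (X ⇒ U k) fun B => (pi X fun x => trunc k (B ⬝ x)) ⇒ trunc k (pi X fun x => B ⬝ x)

/-- `T` is a projective presentation: a presentation all of whose members are projective. -/
def isProjectivePresentation (i j : ℕ) (I T : Exp) : Exp :=
  prod (max i j + 1) (isPresentation i j I T)
    (pi (U i) fun X => mem i j I T X ⇒ isProjective (max i j) X)

/-- The `T`-sheafification of `X`: the nullification of `X` at the propositions `‖T a‖`. -/
def sheafify (i j : ℕ) (I T X : Exp) : Exp :=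
  null (max i j) I (lam I fun a => trunc i (T ⬝ a)) X

/-- `f : X → Y` is `T`-surjective: its fibres are `T`-merely inhabited. -/
def isSurjective (i j : ℕ) (I T X Y f : Exp) : Exp :=
  pi Y fun y => sheafify i j I T (trunc i (fib i X Y f y))

/-- `f : X → Y` is a `T`-cover: all its fibres are in `T`. -/
def isCover (i j : ℕ) (I T X Y f : Exp) : Exp :=
  pi Y fun y => mem i j I T (fib i X Y f y)

end HoTT

open HoTT

/-! Call an index `a : I` with a map `T a → F` a partial element of `F`, and let `Q F` be the
proposition that one merely exists. `Q F` is null at each `‖T a‖`: given `‖T a‖ → Q F`, projectivity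
of `T a` merely chooses partial elements `T (b x) → F` for `x : T a`, and together these form one
map out of `∑ x, T (b x)`, which is in `T`. Since `1 ∈ T`, also `‖F‖` implies `Q F`. Hence `○_T ‖F‖`
implies `Q F`. Apply this to `F = fib f (g d)`. Projectivity of `D` merely gives `a : D → I` and `v
d : T (a d) → fib f (g d)`. Let `Z = ∑ d, T (a d)` and let `p` be the projection: its fibre over `d`
equals `T (a d)` by univalence, and the two components of `v d t` are `h` and the commuting square.

The theorem asks for a derivation, for all `i` and `j`. The argument is therefore written as a raw
term, `localPartialChoiceProof`, and the derivation comes from a type checker whose positive answers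
are derivable (`Checker.sound_ofDepth`). The checker computes with symbolic levels, so a single run
covers all `i` and `j`. No metatheory of the calculus is developed: the checker verifies each
premise that a rule demands. -/

namespace HoTT

/-! ### Symbolic universe levels -/

/-- The numeral `a + 8 * b` stands for a universe level that depends on `i` and `j`: a digit
`a = a' + 1` contributes `i + a'`, a digit `b = b' + 1` contributes `j + b'`, and a digit `0`
contributes nothing. -/
def level (i j n : ℕ) : ℕ :=
  match n % 8, n / 8 with
  | 0, 0 => 0
  | a + 1, 0 => i + a
  | 0, b + 1 => j + b
  | a + 1, b + 1 => max (i + a) (j + b)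

/-- Digitwise comparison suffices for the inequality at all `i` and `j`: the shift by one puts the
digit `0`, which contributes nothing, below all others. -/
def levelLe (m n : ℕ) : Bool := (m % 8).ble (n % 8) && (m / 8).ble (n / 8)

def levelMax (m n : ℕ) : ℕ :=
  (bif (m % 8).ble (n % 8) then n % 8 else m % 8) +
    8 * (bif (m / 8).ble (n / 8) then n / 8 else m / 8)

/-- The level `0` has no successor here, because the constant `1` has no numeral. Two nonzero digits
both grow, since the successor distributes over the maximum. The bound `6` prevents a carry. -/
def levelSucc (n : ℕ) : Option ℕ :=
  bif (n % 8).ble 6 then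
    match n % 8, n / 8 with
    | 0, 0 => none
    | _ + 1, 0 => some (n + 1)
    | 0, _ + 1 => some (n + 8)
    | _ + 1, _ + 1 => some (n + 9)
  else none

theorem level_eq (i j n : ℕ) : level i j n =
    max (if n % 8 = 0 then 0 else i + (n % 8 - 1)) (if n / 8 = 0 then 0 else j + (n / 8 - 1)) := by
  unfold level
  split <;> simp_all

theorem level_mono {m n : ℕ} (i j : ℕ) (h : levelLe m n = true) : level i j m ≤ level i j n := by
  simp only [levelLe, Bool.and_eq_true, Nat.ble_eq] at h
  rw [level_eq, level_eq]
  generalize m % 8 = a, n % 8 = b, m / 8 = c, n / 8 = d at h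
  split_ifs <;> omega

theorem level_levelMax (i j m n : ℕ) :
    level i j (levelMax m n) = max (level i j m) (level i j n) := by
  have h1 : levelMax m n % 8 = max (m % 8) (n % 8) := by
    simp only [levelMax, cond_eq_ite, Nat.ble_eq]; split_ifs <;> omega
  have h2 : levelMax m n / 8 = max (m / 8) (n / 8) := by
    simp only [levelMax, cond_eq_ite, Nat.ble_eq]; split_ifs <;> omega
  have digit (l a b : ℕ) : (if max a b = 0 then 0 else l + (max a b - 1)) =
      max (if a = 0 then 0 else l + (a - 1)) (if b = 0 then 0 else l + (b - 1)) := by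
    split_ifs <;> omega
  rw [level_eq, level_eq, level_eq, h1, h2, digit, digit, max_max_max_comm]

theorem level_levelSucc {n n' : ℕ} (i j : ℕ) (h : levelSucc n = some n') :
    level i j n' = level i j n + 1 := by
  unfold levelSucc at h
  rw [cond_eq_ite] at h
  split_ifs at h with h7
  rw [Nat.ble_eq] at h7
  rw [level_eq, level_eq]
  split at h <;> simp only [Option.some.injEq, reduceCtorEq] at h <;> subst h <;>
    split_ifs <;> omega

/-! ### Relabelling universe levels -/

def Cst.relabel (φ : ℕ → ℕ) : Cst → Cst
  | .empty => .empty
  | .indEmpty k => .indEmpty (φ k)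
  | .unit => .unit
  | .star => .star
  | .indUnit k => .indUnit (φ k)
  | .sum i => .sum (φ i)
  | .inl i => .inl (φ i)
  | .inr i => .inr (φ i)
  | .indSum i k => .indSum (φ i) (φ k)
  | .nat => .nat
  | .zero => .zero
  | .succ => .succ
  | .indNat k => .indNat (φ k)
  | .sigma i => .sigma (φ i)
  | .pair i => .pair (φ i)
  | .indSigma i k => .indSigma (φ i) (φ k)
  | .ident i => .ident (φ i)
  | .refl i => .refl (φ i)
  | .indIdent i k => .indIdent (φ i) (φ k)
  | .funext i => .funext (φ i)
  | .univalence i => .univalence (φ i)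
  | .trunc i => .trunc (φ i)
  | .truncIn i => .truncIn (φ i)
  | .truncProp i => .truncProp (φ i)
  | .truncRec i k => .truncRec (φ i) (φ k)
  | .null i => .null (φ i)
  | .nullUnit i => .nullUnit (φ i)
  | .nullIsNull i => .nullIsNull (φ i)
  | .nullRec i k => .nullRec (φ i) (φ k)

namespace Tm

def relabel (φ : ℕ → ℕ) : Tm → Tm
  | var n => var n
  | univ i => univ (φ i)
  | pi A B => pi (relabel φ A) (relabel φ B)
  | lam A b => lam (relabel φ A) (relabel φ b)
  | app f a => app (relabel φ f) (relabel φ a)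
  | cst c => cst (c.relabel φ)

theorem relabel_rename (φ : ℕ → ℕ) (t : Tm) (r : ℕ → ℕ) :
    (t.rename r).relabel φ = (t.relabel φ).rename r := by
  induction t generalizing r <;> simp_all [relabel, rename]

theorem relabel_subst (φ : ℕ → ℕ) (t : Tm) (s : ℕ → Tm) :
    (t.subst s).relabel φ = (t.relabel φ).subst (fun n => (s n).relabel φ) := by
  have up_eq (s : ℕ → Tm) : (fun n => (up s n).relabel φ) = up (fun n => (s n).relabel φ) := by
    funext n
    cases n <;> simp [up, relabel, relabel_rename]
  induction t generalizing s <;> simp_all [relabel, subst]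

theorem relabel_inst (φ : ℕ → ℕ) (b a : Tm) :
    (b.inst a).relabel φ = (b.relabel φ).inst (a.relabel φ) := by
  unfold inst
  rw [relabel_subst]
  congr 1
  funext n
  cases n <;> rfl

end Tm

/-! ### Boolean equality of raw terms -/

/-- A number for the kind of a constant, and its levels. -/
def Cst.code : Cst → ℕ × ℕ × ℕ
  | .empty => (0, 0, 0)
  | .indEmpty k => (1, 0, k)
  | .unit => (2, 0, 0)
  | .star => (3, 0, 0)
  | .indUnit k => (4, 0, k)
  | .sum i => (5, i, 0)
  | .inl i => (6, i, 0)
  | .inr i => (7, i, 0)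
  | .indSum i k => (8, i, k)
  | .nat => (9, 0, 0)
  | .zero => (10, 0, 0)
  | .succ => (11, 0, 0)
  | .indNat k => (12, 0, k)
  | .sigma i => (13, i, 0)
  | .pair i => (14, i, 0)
  | .indSigma i k => (15, i, k)
  | .ident i => (16, i, 0)
  | .refl i => (17, i, 0)
  | .indIdent i k => (18, i, k)
  | .funext i => (19, i, 0)
  | .univalence i => (20, i, 0)
  | .trunc i => (21, i, 0)
  | .truncIn i => (22, i, 0)
  | .truncProp i => (23, i, 0)
  | .truncRec i k => (24, i, k)
  | .null i => (25, i, 0)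
  | .nullUnit i => (26, i, 0)
  | .nullIsNull i => (27, i, 0)
  | .nullRec i k => (28, i, k)

theorem Cst.code_injective : Function.Injective Cst.code := by
  intro c d h
  cases c <;> cases d <;> simp_all [Cst.code]

def Cst.beq (c d : Cst) : Bool :=
  c.code.1.beq d.code.1 && c.code.2.1.beq d.code.2.1 && c.code.2.2.beq d.code.2.2

theorem Cst.eq_of_beq {c d : Cst} (h : c.beq d = true) : c = d := by
  simp only [Cst.beq, Bool.and_eq_true, Nat.beq_eq] at h
  exact Cst.code_injective (Prod.ext h.1.1 (Prod.ext h.1.2 h.2))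

def Tm.beq : Tm → Tm → Bool
  | .var n, .var n' => n.beq n'
  | .univ i, .univ i' => i.beq i'
  | .pi A B, .pi A' B' => A.beq A' && B.beq B'
  | .lam A b, .lam A' b' => A.beq A' && b.beq b'
  | .app f a, .app f' a' => f.beq f' && a.beq a'
  | .cst c, .cst c' => c.beq c'
  | _, _ => false

theorem Tm.eq_of_beq {t u : Tm} (h : t.beq u = true) : t = u := by
  induction t generalizing u <;> cases u <;> simp_all [Tm.beq]
  case pi ihA ihB _ _ => exact ⟨ihA h.1, ihB h.2⟩
  case lam ihA ihB _ _ => exact ⟨ihA h.1, ihB h.2⟩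
  case app ihA ihB _ _ => exact ⟨ihA h.1, ihB h.2⟩
  case cst => exact Cst.eq_of_beq h

/-! ### The types of the constants at symbolic levels -/

/-- The type of the univalence axiom for `U i`, where `s` is the successor of `i`. -/
def univalenceType (s i : ℕ) : Exp :=
  pi (U i) fun A => pi (U i) fun B =>
    isEquiv s (ident s (U i) A B) (equiv i A B)
      (const (.indIdent s i) ⬝ U i
        ⬝ (lam (U i) fun X => lam (U i) fun Y => lam (ident s (U i) X Y) fun _ => equiv i X Y)
        ⬝ (lam (U i) fun X => idEquiv i X)
        ⬝ A ⬝ B)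

/-- `Y` is `B`-null, stated at the level `l`. -/
def isNullAt (l : ℕ) (A B Y : Exp) : Exp :=
  pi A fun a => isEquiv l Y ((B ⬝ a) ⇒ Y) (lam Y fun y => lam (B ⬝ a) fun _ => y)

/-- The type of the constant `nullRec i k`, where `l` is the maximum of `i` and `k`. -/
def nullRecType (l i k : ℕ) : Exp :=
  pi (U i) fun A => pi (A ⇒ U i) fun B => pi (U i) fun X => pi (U k) fun Y =>
    isNullAt l A B Y ⇒
    isEquiv l (null i A B X ⇒ Y) (X ⇒ Y)
      (lam (null i A B X ⇒ Y) fun g => lam X fun x =>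
        g ⬝ (const (.nullUnit i) ⬝ A ⬝ B ⬝ X ⬝ x))

/-- The type of a constant whose levels are symbolic. -/
def Cst.symType : Cst → Option Tm
  -- The types of these three constants compute `i + 1` or a maximum of levels, and this arithmetic
  -- does not commute with reading numerals as levels. `nullIsNull` does not occur in the proof term
  -- and gets no type.
  | .univalence i =>
    match levelSucc i with
    | some s => some (close (univalenceType s i))
    | none => none
  | .nullIsNull _ => none
  | .nullRec i k => some (close (nullRecType (levelMax i k) i k))
  | c => some (close c.type)

/-- The remaining constants mention levels only as parameters of their types, so both sides agree by
computation. -/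
theorem Cst.close_type_relabel {c : Cst} {A : Tm} (i j : ℕ) (h : c.symType = some A) :
    close (c.relabel (level i j)).type = A.relabel (level i j) := by
  cases c
  case univalence k =>
    simp only [symType] at h
    split at h
    case h_1 s hs =>
      obtain rfl := Option.some.inj h
      have e : (close (univalenceType s k)).relabel (level i j) =
        close (univalenceType (level i j s) (level i j k)) := rfl
      rw [e, level_levelSucc i j hs]
      rfl
    case h_2 => cases h
  case nullIsNull => cases h
  case nullRec k l =>
    obtain rfl := Option.some.inj h
    have e : (close (nullRecType (levelMax k l) k l)).relabel (level i j) =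
      close (nullRecType (level i j (levelMax k l)) (level i j k) (level i j l)) := rfl
    rw [e, level_levelMax]
    rfl
  all_goals
    obtain rfl := Option.some.inj h
    rfl

/-! ### A type checker for raw terms with symbolic levels -/

/-- The functions of a type checker. -/
structure Checker where
  /-- a type of `t` -/
  infer (Γ : List Tm) (t : Tm) : Option Tm
  /-- is `t` of type `A`? -/
  check (Γ : List Tm) (t A : Tm) : Bool
  /-- is every term of type `A` of type `B`? -/
  coe (Γ : List Tm) (A B : Tm) : Bool
  /-- a weak head normal form of the type `A` -/
  whnf (Γ : List Tm) (A : Tm) : Tm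
  /-- a head reduct of `t` and a type of both -/
  step (Γ : List Tm) (t : Tm) : Option (Tm × Tm)
  /-- a type at which `a` and `b` are judgmentally equal -/
  eq (Γ : List Tm) (a b : Tm) : Option Tm
  /-- are `a` and `b` judgmentally equal at the type `A`? -/
  eqAt (Γ : List Tm) (a b A : Tm) : Bool

namespace Tm

def level? : Tm → Option ℕ
  | univ k => some k
  | _ => none

def pi? : Tm → Option (Tm × Tm)
  | pi A B => some (A, B)
  | _ => none

/-- For an eliminator applied to a constructor: the same term with the arguments of the constructor
adjusted to those of the eliminator, and the contractum. -/
def iota : Tm → Option (Tm × Tm)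
  | app (app (app (app (app (cst (.indSigma i k)) A) B) P) g)
      (app (app (app (app (cst (.pair _)) _) _) a) b) =>
    some (cstApp (.indSigma i k) [A, B, P, g, cstApp (.pair i) [A, B, a, b]], app (app g a) b)
  | app (app (app (app (app (app (cst (.indIdent i k)) A) P) c) x) _)
      (app (app (cst (.refl _)) _) _) =>
    some (cstApp (.indIdent i k) [A, P, c, x, x, cstApp (.refl i) [A, x]], app c x)
  | _ => none

/-- Is this an eliminator that lacks only its last argument? -/
def isElim : Tm → Bool
  | app (app (app (app (cst (.indSigma _ _)) _) _) _) _ => true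
  | app (app (app (app (app (cst (.indIdent _ _)) _) _) _) _) _ => true
  | _ => false

end Tm

namespace Checker

def bot : Checker where
  infer _ _ := none
  check _ _ _ := false
  coe _ _ _ := false
  whnf _ A := A
  step _ _ := none
  eq _ _ _ := none
  eqAt _ _ _ _ := false

variable (c : Checker)

/-- The level of the universe that `K` is convertible to. -/
def asLevel (Γ : List Tm) : Tm → Option ℕ
  | .univ k => some k
  | K => (c.whnf Γ K).level?

/-- The domain and the codomain of the function type that `F` is convertible to. -/
def asPi (Γ : List Tm) : Tm → Option (Tm × Tm)
  | .pi A B => some (A, B)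
  | F => (c.whnf Γ F).pi?

/-- The level of a universe that contains `A`. -/
def typeLevel (Γ : List Tm) (A : Tm) : Option ℕ :=
  (c.infer Γ A).bind fun K => c.asLevel Γ K

/-- The level of a universe in which `A` and `B` are judgmentally equal. -/
def eqLevel (Γ : List Tm) (A B : Tm) : Option ℕ :=
  (c.eq Γ A B).bind fun K => c.asLevel Γ K

/-- The type of `f a` where `B` is the codomain of `f` and `A` is the type of `a`. If it is an
abstraction applied to `a`, it is reduced. -/
def resultType (Γ : List Tm) (A B a : Tm) : Tm :=
  match B.inst a with
  | .app (.lam A' Q) a' =>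
    -- These are premises of the rule `beta` for this redex; that `a` has type `A` is known from the
    -- application.
    bif A'.beq A && a'.beq a && (c.typeLevel Γ A).isSome && (c.typeLevel (A :: Γ) Q).isSome then
      Q.inst a
    else .app (.lam A' Q) a'
  | R => R

/-- Typing, conversion and reduction call one another with no evident decreasing measure. Each
function is therefore one layer, whose recursive calls go to `c`, and the recursion is on the depth.
-/
def nextInfer (Γ : List Tm) : Tm → Option Tm
  | .var n => Γ[n]?.map fun A => A.rename fun m => m + (n + 1)
  | .univ i => (levelSucc i).map .univ
  | .pi A B => (c.typeLevel Γ A).bind fun k => (c.typeLevel (A :: Γ) B).map fun l =>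
      .univ (levelMax k l)
  | .lam A b => (c.typeLevel Γ A).bind fun _ => (c.infer (A :: Γ) b).map fun B => .pi A B
  | .app f a => (c.infer Γ f).bind fun F => (c.asPi Γ F).bind fun AB =>
      bif c.check Γ a AB.1 then some (c.resultType Γ AB.1 AB.2 a) else none
  | .cst d => d.symType

/-- Is `A` convertible to the domain of the function type with domain `A'` and codomain `B'`? -/
def domain (Γ : List Tm) (A A' B' : Tm) : Bool :=
  (c.typeLevel Γ A).isSome &&
    (A.beq A' || ((c.eqLevel Γ A A').isSome && (c.typeLevel (A :: Γ) B').isSome))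

def inferCheck (Γ : List Tm) (t T : Tm) : Bool :=
  match c.infer Γ t with
  | some T' => c.coe Γ T' T
  | none => false

def nextCheck (Γ : List Tm) (t T : Tm) : Bool :=
  match t with
  -- Cumulativity does not pass under `Π`. The body is therefore checked against the expected
  -- codomain, where universes can be raised.
  | .lam A b =>
    match c.asPi Γ T with
    | some (A', B') => c.domain Γ A A' B' && c.check (A :: Γ) b B'
    | none => false
  | t => c.inferCheck Γ t T

def coeWhnf (Γ : List Tm) : Tm → Tm → Bool
  | .univ k, .univ l => levelLe k l
  | A, B => (c.eqLevel Γ A B).isSome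

def nextCoe (Γ : List Tm) (A B : Tm) : Bool :=
  A.beq B || c.coeWhnf Γ (c.whnf Γ A) (c.whnf Γ B)

def nextWhnf (Γ : List Tm) (A : Tm) : Tm :=
  match A with
  | .pi A B => .pi A B
  | .univ k => .univ k
  | A =>
    match c.step Γ A with
    | none => A
    | some (A', K) =>
      -- A reduction of `A` is an equality of types only if it takes place in a universe.
      match c.asLevel Γ K with
      | some _ => c.whnf Γ A'
      | none => A

/-- The computation rules need the arguments of constructor and eliminator to coincide
syntactically, while in `t` they may be merely convertible. So `t` is first compared with the
adjusted term `r`. -/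
def stepIota (Γ : List Tm) (t r u : Tm) : Option (Tm × Tm) :=
  (c.infer Γ r).bind fun T =>
    bif c.check Γ u T && (t.beq r || c.eqAt Γ t r T) then some (u, T) else none

def stepApp (Γ : List Tm) (f a : Tm) : Option (Tm × Tm) :=
  match c.step Γ f with
  | some (f', F) => (c.asPi Γ F).bind fun AB =>
      bif c.check Γ a AB.1 then some (.app f' a, AB.2.inst a) else none
  | none =>
    bif f.isElim then
      (c.step Γ a).bind fun aA => (c.infer Γ f).bind fun F => (c.asPi Γ F).bind fun AB =>
        bif c.coe Γ aA.2 AB.1 then some (.app f aA.1, AB.2.inst a) else none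
    else none

def nextStep (Γ : List Tm) (t : Tm) : Option (Tm × Tm) :=
  match t with
  | .app (.lam A b) a =>
    (c.typeLevel Γ A).bind fun _ => (c.infer (A :: Γ) b).bind fun B =>
      bif c.check Γ a A then some (b.inst a, B.inst a) else none
  | .app f a =>
    match (Tm.app f a).iota with
    | some (r, u) => c.stepIota Γ (.app f a) r u
    | none => c.stepApp Γ f a
  | _ => none

def eqCong (Γ : List Tm) : Tm → Tm → Option Tm
  | .pi A B, .pi A' B' => (c.typeLevel Γ A).bind fun k => (c.eqLevel Γ A A').bind fun k' =>
      (c.eqLevel (A :: Γ) B B').map fun l => .univ (levelMax k (levelMax k' l))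
  | .lam A b, .lam A' b' => (c.typeLevel Γ A).bind fun _ => (c.eqLevel Γ A A').bind fun _ =>
      (c.eq (A :: Γ) b b').map fun B => .pi A B
  | .app f a, .app f' a' => (c.eq Γ f f').bind fun F => (c.asPi Γ F).bind fun AB =>
      bif c.eqAt Γ a a' AB.1 then some (AB.2.inst a) else none
  | _, _ => none

/-- Transitivity needs a common type, and cumulativity makes coercion one-directional, so both
directions are tried. -/
def join (Γ : List Tm) (A B : Tm) : Option Tm :=
  bif c.coe Γ A B then some B else bif c.coe Γ B A then some A else none

/-- Congruence is tried before reduction, so that terms whose parts already agree are not unfolded.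
-/
def nextEq (Γ : List Tm) (a b : Tm) : Option Tm :=
  bif a.beq b then c.infer Γ a else
    match c.eqCong Γ a b with
    | some T => some T
    | none =>
      match c.step Γ a with
      | some (a', T) => (c.eq Γ a' b).bind fun T' => c.join Γ T T'
      | none => (c.step Γ b).bind fun bT => (c.eq Γ a bT.1).bind fun T' => c.join Γ bT.2 T'

def eqCoe (Γ : List Tm) (a b T : Tm) : Bool :=
  match c.eq Γ a b with
  | some T' => c.coe Γ T' T
  | none => false

def nextEqAt (Γ : List Tm) (a b T : Tm) : Bool :=
  bif a.beq b then c.check Γ a T else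
    match a, b with
    | .lam A x, .lam A' x' =>
      match c.asPi Γ T with
      | some (A₀, B₀) => c.domain Γ A A₀ B₀ && (A.beq A' || (c.eqLevel Γ A A').isSome) &&
          c.eqAt (A :: Γ) x x' B₀
      | none => false
    | a, b => c.eqCoe Γ a b T

/-- One more level of recursion. -/
def next : Checker where
  infer := c.nextInfer
  check := c.nextCheck
  coe := c.nextCoe
  whnf := c.nextWhnf
  step := c.nextStep
  eq := c.nextEq
  eqAt := c.nextEqAt

/-- The checker whose recursion depth is `n`. -/
def ofDepth : ℕ → Checker
  | 0 => bot
  | n + 1 => (ofDepth n).next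

end Checker
/-! ### Soundness of the checker -/

section Rules

variable (i j : ℕ)

/-- Derivability of `Γ ctx` when the symbolic levels are read at `i` and `j`. -/
def Ctx (Γ : List Tm) : Prop := Derivable (.isCtx (Γ.map (Tm.relabel (level i j))))

/-- Derivability of `Γ ⊢ t : A` when the symbolic levels are read at `i` and `j`. -/
def Has (Γ : List Tm) (t A : Tm) : Prop :=
  Derivable (.hasType (Γ.map (Tm.relabel (level i j))) (t.relabel (level i j))
    (A.relabel (level i j)))

/-- Derivability of `Γ ⊢ t = u : A` when the symbolic levels are read at `i` and `j`. -/
def Conv (Γ : List Tm) (t u A : Tm) : Prop :=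
  Derivable (.isEq (Γ.map (Tm.relabel (level i j))) (t.relabel (level i j))
    (u.relabel (level i j)) (A.relabel (level i j)))

/-- Equality of types, either judgmental or syntactic. -/
def TyEq (Γ : List Tm) (A B : Tm) : Prop := A = B ∨ ∃ k, Conv i j Γ A B (.univ k)

/-- Everything of type `A` is of type `B`. -/
def Coe (Γ : List Tm) (A B : Tm) : Prop :=
  (∀ t, Has i j Γ t A → Has i j Γ t B) ∧ ∀ t u, Conv i j Γ t u A → Conv i j Γ t u B

variable {i j} {Γ : List Tm} {A A' A'' B B' K t u v f f' a a' b b' : Tm} {k l m n : ℕ}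

theorem Has.cons (h : Has i j Γ A (.univ k)) : Ctx i j (A :: Γ) := Derivable.ctxCons h

theorem Has.cumul (h : Has i j Γ A (.univ k)) (hkl : level i j k ≤ level i j l) :
    Has i j Γ A (.univ l) := Derivable.cumul h hkl

theorem Conv.cumul (h : Conv i j Γ A B (.univ k)) (hkl : level i j k ≤ level i j l) :
    Conv i j Γ A B (.univ l) := Derivable.eqCumul h hkl

theorem level_le_levelMax_left (i j k l : ℕ) : level i j k ≤ level i j (levelMax k l) := by
  rw [level_levelMax]; exact le_max_left _ _

theorem level_le_levelMax_right (i j k l : ℕ) : level i j l ≤ level i j (levelMax k l) := by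
  rw [level_levelMax]; exact le_max_right _ _

theorem Has.var (hΓ : Ctx i j Γ) (h : Γ[n]? = some A) :
    Has i j Γ (.var n) (A.rename fun m => m + (n + 1)) := by
  unfold Has
  rw [Tm.relabel_rename]
  exact Derivable.var hΓ (by simp [h])

theorem Has.univ (hΓ : Ctx i j Γ) (h : levelSucc k = some l) :
    Has i j Γ (.univ k) (.univ l) := by
  unfold Has
  simp only [Tm.relabel, level_levelSucc i j h]
  exact Derivable.univ hΓ

theorem Has.cst {c : Cst} (hΓ : Ctx i j Γ) (h : c.symType = some A) : Has i j Γ (.cst c) A := by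
  unfold Has
  rw [← Cst.close_type_relabel i j h]
  exact Derivable.cst _ hΓ

/-- The rule asks for a common universe; cumulativity raises both premises to the maximum. -/
theorem Has.pi (hA : Has i j Γ A (.univ k)) (hB : Has i j (A :: Γ) B (.univ l)) :
    Has i j Γ (.pi A B) (.univ (levelMax k l)) :=
  Derivable.pi (hA.cumul (level_le_levelMax_left ..)) (hB.cumul (level_le_levelMax_right ..))

theorem Has.lam (hb : Has i j (A :: Γ) b B) : Has i j Γ (.lam A b) (.pi A B) := Derivable.lam hb

theorem Has.app (hf : Has i j Γ f (.pi A B)) (ha : Has i j Γ a A) :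
    Has i j Γ (.app f a) (B.inst a) := by
  unfold Has
  rw [Tm.relabel_inst]
  exact Derivable.app hf ha

theorem Conv.refl (h : Has i j Γ t A) : Conv i j Γ t t A := Derivable.eqRefl h

theorem Conv.symm (h : Conv i j Γ t u A) : Conv i j Γ u t A := Derivable.eqSymm h

theorem Conv.trans (h : Conv i j Γ t u A) (h' : Conv i j Γ u v A) : Conv i j Γ t v A :=
  Derivable.eqTrans h h'

theorem Conv.app (hf : Conv i j Γ f f' (.pi A B)) (ha : Conv i j Γ a a' A) :
    Conv i j Γ (.app f a) (.app f' a') (B.inst a) := by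
  unfold Conv
  rw [Tm.relabel_inst]
  exact Derivable.eqApp hf ha

theorem Conv.lam (hA : Has i j Γ A (.univ k)) (hAA' : Conv i j Γ A A' (.univ l))
    (hb : Conv i j (A :: Γ) b b' B) : Conv i j Γ (.lam A b) (.lam A' b') (.pi A B) :=
  Derivable.eqLam (hA.cumul (level_le_levelMax_left ..))
    (hAA'.cumul (level_le_levelMax_right ..)) hb

theorem Conv.pi (hA : Has i j Γ A (.univ k)) (hAA' : Conv i j Γ A A' (.univ l))
    (hB : Conv i j (A :: Γ) B B' (.univ m)) :
    Conv i j Γ (.pi A B) (.pi A' B') (.univ (levelMax k (levelMax l m))) :=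
  Derivable.eqPi (hA.cumul (level_le_levelMax_left ..))
    (hAA'.cumul ((level_le_levelMax_left ..).trans (level_le_levelMax_right ..)))
    (hB.cumul ((level_le_levelMax_right ..).trans (level_le_levelMax_right ..)))

theorem Conv.beta (hb : Has i j (A :: Γ) b B) (ha : Has i j Γ a A) :
    Conv i j Γ (.app (.lam A b) a) (b.inst a) (B.inst a) := by
  unfold Conv
  rw [Tm.relabel_inst, Tm.relabel_inst]
  exact Derivable.beta hb ha

theorem Tm.comp_relabel_of_iota {r : Tm} (φ : ℕ → ℕ) (h : t.iota = some (r, u)) :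
    Comp (r.relabel φ) (u.relabel φ) := by
  unfold Tm.iota at h
  split at h
  · simp only [Option.some.injEq, Prod.mk.injEq] at h
    obtain ⟨rfl, rfl⟩ := h
    exact Comp.indSigma ..
  · simp only [Option.some.injEq, Prod.mk.injEq] at h
    obtain ⟨rfl, rfl⟩ := h
    exact Comp.indIdent ..
  · cases h

theorem Conv.iota {r : Tm} (h : t.iota = some (r, u)) (hr : Has i j Γ r A) (hu : Has i j Γ u A) :
    Conv i j Γ r u A :=
  Derivable.comp (Tm.comp_relabel_of_iota _ h) hr hu

theorem TyEq.symm (h : TyEq i j Γ A B) : TyEq i j Γ B A := by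
  obtain rfl | ⟨k, h⟩ := h
  · exact .inl rfl
  · exact .inr ⟨k, h.symm⟩

theorem TyEq.trans (h : TyEq i j Γ A A') (h' : TyEq i j Γ A' A'') : TyEq i j Γ A A'' := by
  obtain rfl | ⟨k, h⟩ := h
  · exact h'
  obtain rfl | ⟨l, h'⟩ := h'
  · exact .inr ⟨k, h⟩
  · exact .inr ⟨levelMax k l, (h.cumul (level_le_levelMax_left ..)).trans
      (h'.cumul (level_le_levelMax_right ..))⟩

/-- The syntactic case needs no derivation that `A` is a type, which reflexivity of judgmental
equality would require. -/
theorem TyEq.coe (h : TyEq i j Γ A B) : Coe i j Γ A B := by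
  obtain rfl | ⟨k, h⟩ := h
  · exact ⟨fun _ => id, fun _ _ => id⟩
  · exact ⟨fun _ ht => Derivable.conv ht h, fun _ _ ht => Derivable.eqConv ht h⟩

theorem Coe.trans (h : Coe i j Γ A A') (h' : Coe i j Γ A' A'') : Coe i j Γ A A'' :=
  ⟨fun t ht => h'.1 t (h.1 t ht), fun t u ht => h'.2 t u (h.2 t u ht)⟩

theorem Coe.univ (h : level i j k ≤ level i j l) : Coe i j Γ (.univ k) (.univ l) :=
  ⟨fun _ ht => ht.cumul h, fun _ _ ht => ht.cumul h⟩

/-- Changing the domain of a function type. -/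
theorem TyEq.pi (hA : Has i j Γ A (.univ k)) (hAA' : Conv i j Γ A A' (.univ l))
    (hB : Has i j (A :: Γ) B (.univ m)) : TyEq i j Γ (.pi A B) (.pi A' B) :=
  .inr ⟨_, Conv.pi hA hAA' (.refl hB)⟩

end Rules

/-! ### Soundness by induction on the recursion depth -/

namespace Checker

/-- The positive answers of the checker are derivable. -/
structure Sound (i j : ℕ) (c : Checker) : Prop where
  infer {Γ t A} : Ctx i j Γ → c.infer Γ t = some A → Has i j Γ t A
  check {Γ t A} : Ctx i j Γ → c.check Γ t A = true → Has i j Γ t A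
  coe {Γ A B} : Ctx i j Γ → c.coe Γ A B = true → Coe i j Γ A B
  whnf {Γ A} : Ctx i j Γ → TyEq i j Γ A (c.whnf Γ A)
  step {Γ t u A} : Ctx i j Γ → c.step Γ t = some (u, A) → Conv i j Γ t u A
  eq {Γ t u A} : Ctx i j Γ → c.eq Γ t u = some A → Conv i j Γ t u A
  eqAt {Γ t u A} : Ctx i j Γ → c.eqAt Γ t u A = true → Conv i j Γ t u A

theorem sound_bot (i j : ℕ) : Sound i j bot where
  infer _ h := by cases h
  check _ h := by cases h
  coe _ h := by cases h
  whnf _ := .inl rfl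
  step _ h := by cases h
  eq _ h := by cases h
  eqAt _ h := by cases h

namespace Sound

variable {i j : ℕ} {c : Checker} {Γ : List Tm} {A A' B B' F K T t u f a b : Tm} {k : ℕ}

theorem asLevel (hc : Sound i j c) (hΓ : Ctx i j Γ) (h : c.asLevel Γ K = some k) :
    TyEq i j Γ K (.univ k) := by
  unfold Checker.asLevel at h
  split at h
  · obtain rfl := Option.some.inj h
    exact .inl rfl
  · have := hc.whnf (A := K) hΓ
    unfold Tm.level? at h
    split at h
    case h_1 e =>
      obtain rfl := Option.some.inj h
      rwa [e] at this
    case h_2 => cases h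

theorem asPi (hc : Sound i j c) (hΓ : Ctx i j Γ) (h : c.asPi Γ F = some (A, B)) :
    TyEq i j Γ F (.pi A B) := by
  unfold Checker.asPi at h
  split at h
  · cases h
    exact .inl rfl
  · have := hc.whnf (A := F) hΓ
    unfold Tm.pi? at h
    split at h
    case h_1 e =>
      cases h
      rwa [e] at this
    case h_2 => cases h

theorem typeLevel (hc : Sound i j c) (hΓ : Ctx i j Γ) (h : c.typeLevel Γ A = some k) :
    Has i j Γ A (.univ k) := by
  obtain ⟨K, hK, h⟩ := Option.bind_eq_some_iff.1 h
  exact (hc.asLevel hΓ h).coe.1 _ (hc.infer hΓ hK)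

theorem eqLevel (hc : Sound i j c) (hΓ : Ctx i j Γ) (h : c.eqLevel Γ A B = some k) :
    Conv i j Γ A B (.univ k) := by
  obtain ⟨K, hK, h⟩ := Option.bind_eq_some_iff.1 h
  exact (hc.asLevel hΓ h).coe.2 _ _ (hc.eq hΓ hK)

theorem resultType (hc : Sound i j c) (hΓ : Ctx i j Γ) (ha : Has i j Γ a A) :
    TyEq i j Γ (B.inst a) (c.resultType Γ A B a) := by
  unfold Checker.resultType
  split
  case h_1 A' Q a' e =>
    rw [e, cond_eq_ite]
    split_ifs with h
    · simp only [Bool.and_eq_true, Option.isSome_iff_exists] at h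
      obtain ⟨⟨⟨hA', ha'⟩, l, hl⟩, k, hk⟩ := h
      obtain rfl := Tm.eq_of_beq hA'
      obtain rfl := Tm.eq_of_beq ha'
      exact .inr ⟨k, Conv.beta (hc.typeLevel (hc.typeLevel hΓ hl).cons hk) ha⟩
    · exact .inl rfl
  case h_2 => exact .inl rfl

theorem nextInfer (hc : Sound i j c) (hΓ : Ctx i j Γ) (h : c.nextInfer Γ t = some A) :
    Has i j Γ t A := by
  cases t with
  | var n =>
    obtain ⟨B, hB, rfl⟩ := Option.map_eq_some_iff.1 h
    exact .var hΓ hB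
  | univ k =>
    obtain ⟨l, hl, rfl⟩ := Option.map_eq_some_iff.1 h
    exact .univ hΓ hl
  | pi A B =>
    obtain ⟨k, hk, h⟩ := Option.bind_eq_some_iff.1 h
    obtain ⟨l, hl, rfl⟩ := Option.map_eq_some_iff.1 h
    have hA := hc.typeLevel hΓ hk
    exact .pi hA (hc.typeLevel hA.cons hl)
  | lam A b =>
    obtain ⟨k, hk, h⟩ := Option.bind_eq_some_iff.1 h
    obtain ⟨B, hB, rfl⟩ := Option.map_eq_some_iff.1 h
    exact .lam (hc.infer (hc.typeLevel hΓ hk).cons hB)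
  | app f a =>
    obtain ⟨F, hF, h⟩ := Option.bind_eq_some_iff.1 h
    obtain ⟨⟨B, B'⟩, hB, h⟩ := Option.bind_eq_some_iff.1 h
    rw [cond_eq_ite] at h
    split_ifs at h with ha
    obtain rfl := Option.some.inj h
    have ha := hc.check hΓ ha
    exact (hc.resultType hΓ ha).coe.1 _ (.app ((hc.asPi hΓ hB).coe.1 _ (hc.infer hΓ hF)) ha)
  | cst d => exact .cst hΓ h

/-- The body of an abstraction is typed over its own domain `A`, and the equality of function types
then moves the result to the domain `A'`. No judgment has to be transported to another context. -/
theorem domain (hc : Sound i j c) (hΓ : Ctx i j Γ) (h : c.domain Γ A A' B' = true) :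
    Ctx i j (A :: Γ) ∧ TyEq i j Γ (.pi A B') (.pi A' B') := by
  simp only [Checker.domain, Bool.and_eq_true, Bool.or_eq_true, Option.isSome_iff_exists] at h
  obtain ⟨⟨k, hk⟩, h⟩ := h
  have hA := hc.typeLevel hΓ hk
  refine ⟨hA.cons, ?_⟩
  obtain h | ⟨⟨l, hl⟩, m, hm⟩ := h
  · exact .inl (by rw [Tm.eq_of_beq h])
  · exact .pi hA (hc.eqLevel hΓ hl) (hc.typeLevel hA.cons hm)

theorem inferCheck (hc : Sound i j c) (hΓ : Ctx i j Γ) (h : c.inferCheck Γ t T = true) :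
    Has i j Γ t T := by
  unfold Checker.inferCheck at h
  split at h
  case h_1 T' hT' => exact (hc.coe hΓ h).1 _ (hc.infer hΓ hT')
  case h_2 => cases h

theorem nextCheck (hc : Sound i j c) (hΓ : Ctx i j Γ) (h : c.nextCheck Γ t T = true) :
    Has i j Γ t T := by
  unfold Checker.nextCheck at h
  split at h
  · split at h
    case h_1 A b _ A' B' hT =>
      rw [Bool.and_eq_true] at h
      obtain ⟨hA, hAB⟩ := hc.domain hΓ h.1
      exact (hc.asPi hΓ hT).symm.coe.1 _ (hAB.coe.1 _ (.lam (hc.check hA h.2)))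
    case h_2 => cases h
  · exact hc.inferCheck hΓ h

theorem coeWhnf (hc : Sound i j c) (hΓ : Ctx i j Γ) (h : c.coeWhnf Γ A B = true) :
    Coe i j Γ A B := by
  unfold Checker.coeWhnf at h
  split at h
  · exact .univ (level_mono i j h)
  · obtain ⟨k, hk⟩ := Option.isSome_iff_exists.1 h
    exact TyEq.coe (.inr ⟨k, hc.eqLevel hΓ hk⟩)

theorem nextCoe (hc : Sound i j c) (hΓ : Ctx i j Γ) (h : c.nextCoe Γ A B = true) :
    Coe i j Γ A B := by
  rw [Checker.nextCoe, Bool.or_eq_true] at h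
  obtain h | h := h
  · exact TyEq.coe (.inl (Tm.eq_of_beq h))
  · exact ((hc.whnf hΓ).coe.trans (hc.coeWhnf hΓ h)).trans (hc.whnf hΓ).symm.coe

theorem nextWhnf (hc : Sound i j c) (hΓ : Ctx i j Γ) : TyEq i j Γ A (c.nextWhnf Γ A) := by
  unfold Checker.nextWhnf
  split
  · exact .inl rfl
  · exact .inl rfl
  · split
    · exact .inl rfl
    case h_2 A' K h =>
      split
      case h_1 k hk =>
        exact TyEq.trans (.inr ⟨k, (hc.asLevel hΓ hk).coe.2 _ _ (hc.step hΓ h)⟩) (hc.whnf hΓ)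
      · exact .inl rfl

theorem stepIota {r : Tm} (hc : Sound i j c) (hΓ : Ctx i j Γ) (hr : t.iota = some (r, u))
    (h : c.stepIota Γ t r u = some (a, A)) : Conv i j Γ t a A := by
  obtain ⟨T, hT, h⟩ := Option.bind_eq_some_iff.1 h
  rw [cond_eq_ite] at h
  split_ifs at h with h'
  cases h
  simp only [Bool.and_eq_true, Bool.or_eq_true] at h'
  have hT := hc.infer hΓ hT
  have htr : Conv i j Γ t r A := by
    obtain h | h := h'.2
    · rw [Tm.eq_of_beq h]
      exact .refl hT
    · exact hc.eqAt hΓ h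
  exact htr.trans (.iota hr hT (hc.check hΓ h'.1))

theorem stepApp (hc : Sound i j c) (hΓ : Ctx i j Γ) (h : c.stepApp Γ f a = some (u, A)) :
    Conv i j Γ (.app f a) u A := by
  unfold Checker.stepApp at h
  split at h
  case h_1 f' F hf =>
    obtain ⟨⟨B, B'⟩, hB, h⟩ := Option.bind_eq_some_iff.1 h
    rw [cond_eq_ite] at h
    split_ifs at h with ha
    cases h
    exact .app ((hc.asPi hΓ hB).coe.2 _ _ (hc.step hΓ hf)) (.refl (hc.check hΓ ha))
  case h_2 =>
    rw [cond_eq_ite] at h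
    split_ifs at h
    obtain ⟨⟨a', A'⟩, ha, h⟩ := Option.bind_eq_some_iff.1 h
    obtain ⟨F, hF, h⟩ := Option.bind_eq_some_iff.1 h
    obtain ⟨⟨B, B'⟩, hB, h⟩ := Option.bind_eq_some_iff.1 h
    rw [cond_eq_ite] at h
    split_ifs at h with hA'
    cases h
    exact .app (.refl ((hc.asPi hΓ hB).coe.1 _ (hc.infer hΓ hF)))
      ((hc.coe hΓ hA').2 _ _ (hc.step hΓ ha))

theorem nextStep (hc : Sound i j c) (hΓ : Ctx i j Γ) (h : c.nextStep Γ t = some (u, A)) :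
    Conv i j Γ t u A := by
  unfold Checker.nextStep at h
  split at h
  · obtain ⟨k, hk, h⟩ := Option.bind_eq_some_iff.1 h
    obtain ⟨B, hB, h⟩ := Option.bind_eq_some_iff.1 h
    rw [cond_eq_ite] at h
    split_ifs at h with ha
    cases h
    exact .beta (hc.infer (hc.typeLevel hΓ hk).cons hB) (hc.check hΓ ha)
  · split at h
    case h_1 hr => exact hc.stepIota hΓ hr h
    case h_2 => exact hc.stepApp hΓ h
  · cases h

theorem eqCong (hc : Sound i j c) (hΓ : Ctx i j Γ) (h : c.eqCong Γ t u = some T) :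
    Conv i j Γ t u T := by
  unfold Checker.eqCong at h
  split at h
  · obtain ⟨k, hk, h⟩ := Option.bind_eq_some_iff.1 h
    obtain ⟨l, hl, h⟩ := Option.bind_eq_some_iff.1 h
    obtain ⟨m, hm, rfl⟩ := Option.map_eq_some_iff.1 h
    have hA := hc.typeLevel hΓ hk
    exact .pi hA (hc.eqLevel hΓ hl) (hc.eqLevel hA.cons hm)
  · obtain ⟨k, hk, h⟩ := Option.bind_eq_some_iff.1 h
    obtain ⟨l, hl, h⟩ := Option.bind_eq_some_iff.1 h
    obtain ⟨B, hB, rfl⟩ := Option.map_eq_some_iff.1 h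
    have hA := hc.typeLevel hΓ hk
    exact .lam hA (hc.eqLevel hΓ hl) (hc.eq hA.cons hB)
  · obtain ⟨F, hF, h⟩ := Option.bind_eq_some_iff.1 h
    obtain ⟨⟨B, B'⟩, hB, h⟩ := Option.bind_eq_some_iff.1 h
    rw [cond_eq_ite] at h
    split_ifs at h with ha
    cases h
    exact .app ((hc.asPi hΓ hB).coe.2 _ _ (hc.eq hΓ hF)) (hc.eqAt hΓ ha)
  · cases h

theorem join (hc : Sound i j c) (hΓ : Ctx i j Γ) (h : c.join Γ A B = some T) :
    Coe i j Γ A T ∧ Coe i j Γ B T := by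
  simp only [Checker.join, cond_eq_ite] at h
  split_ifs at h with h₁ h₂ <;> cases h
  · exact ⟨hc.coe hΓ h₁, TyEq.coe (.inl rfl)⟩
  · exact ⟨TyEq.coe (.inl rfl), hc.coe hΓ h₂⟩

theorem nextEq (hc : Sound i j c) (hΓ : Ctx i j Γ) (h : c.nextEq Γ t u = some T) :
    Conv i j Γ t u T := by
  unfold Checker.nextEq at h
  rw [cond_eq_ite] at h
  split_ifs at h with htu
  · rw [← Tm.eq_of_beq htu]
    exact .refl (hc.infer hΓ h)
  split at h
  case h_1 hT =>
    cases h
    exact hc.eqCong hΓ hT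
  split at h
  case h_1 t' A ht =>
    obtain ⟨B, hB, h⟩ := Option.bind_eq_some_iff.1 h
    obtain ⟨hA, hB'⟩ := hc.join hΓ h
    exact (hA.2 _ _ (hc.step hΓ ht)).trans (hB'.2 _ _ (hc.eq hΓ hB))
  case h_2 =>
    obtain ⟨⟨u', A⟩, hu, h⟩ := Option.bind_eq_some_iff.1 h
    obtain ⟨B, hB, h⟩ := Option.bind_eq_some_iff.1 h
    obtain ⟨hA, hB'⟩ := hc.join hΓ h
    exact (hB'.2 _ _ (hc.eq hΓ hB)).trans (hA.2 _ _ (hc.step hΓ hu)).symm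

theorem eqCoe (hc : Sound i j c) (hΓ : Ctx i j Γ) (h : c.eqCoe Γ t u T = true) :
    Conv i j Γ t u T := by
  unfold Checker.eqCoe at h
  split at h
  case h_1 T' hT' => exact (hc.coe hΓ h).2 _ _ (hc.eq hΓ hT')
  case h_2 => cases h

theorem nextEqAt (hc : Sound i j c) (hΓ : Ctx i j Γ) (h : c.nextEqAt Γ t u T = true) :
    Conv i j Γ t u T := by
  unfold Checker.nextEqAt at h
  rw [cond_eq_ite] at h
  split_ifs at h with htu
  · rw [← Tm.eq_of_beq htu]
    exact .refl (hc.check hΓ h)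
  split at h
  · split at h
    case h_1 A x A' x' _ A₀ B₀ hT =>
      simp only [Bool.and_eq_true, Bool.or_eq_true, Option.isSome_iff_exists] at h
      obtain ⟨⟨hd, hA'⟩, hx⟩ := h
      obtain ⟨hA, hAB⟩ := hc.domain hΓ hd
      have hx := hc.eqAt hA hx
      simp only [Checker.domain, Bool.and_eq_true, Option.isSome_iff_exists] at hd
      obtain ⟨k, hk⟩ := hd.1
      have hk := hc.typeLevel hΓ hk
      refine (hc.asPi hΓ hT).symm.coe.2 _ _ (hAB.coe.2 _ _ ?_)
      obtain h | ⟨l, hl⟩ := hA'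
      · rw [← Tm.eq_of_beq h]
        exact .lam hk (.refl hk) hx
      · exact .lam hk (hc.eqLevel hΓ hl) hx
    case h_2 => cases h
  · exact hc.eqCoe hΓ h

theorem next (hc : Sound i j c) : Sound i j c.next where
  infer := hc.nextInfer
  check := hc.nextCheck
  coe := hc.nextCoe
  whnf := hc.nextWhnf
  step := hc.nextStep
  eq := hc.nextEq
  eqAt := hc.nextEqAt

end Sound

theorem sound_ofDepth (i j n : ℕ) : Sound i j (ofDepth n) := by
  induction n with
  | zero => exact sound_bot i j
  | succ n ih => exact ih.next

/-- A closed term that the checker accepts is derivable at all levels `i` and `j`. -/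
theorem derivable_of_check (i j : ℕ) {n : ℕ} {t A : Tm} (h : (ofDepth n).check [] t A = true) :
    Derivable (.hasType [] (t.relabel (level i j)) (A.relabel (level i j))) :=
  (sound_ofDepth i j n).check (Γ := []) Derivable.ctxNil h

end Checker
/-! ### The statement with its levels as parameters

The levels are `i`, `j`, `m = max i j`, `s = i + 1`, `n = max (i + 1) j`, `q = max i j + 1`. -/

/-- Derived levels are separate parameters, because at symbolic numerals they are in general not
sums and maxima of natural numbers. -/
def memAt (i s n : ℕ) (I T X : Exp) : Exp :=
  trunc n (sigma n I fun a => ident s (U i) (T ⬝ a) X)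

def sigmaClosed (i s n : ℕ) (I T : Exp) : Exp :=
  pi (U i) fun X => pi (X ⇒ U i) fun B =>
    memAt i s n I T X ⇒ (pi X fun x => memAt i s n I T (B ⬝ x)) ⇒
      memAt i s n I T (sigma i X fun x => B ⬝ x)

def isPresentationAt (i s n : ℕ) (I T : Exp) : Exp :=
  prod n (memAt i s n I T unit) (sigmaClosed i s n I T)

def membersProjective (i m s n : ℕ) (I T : Exp) : Exp :=
  pi (U i) fun X => memAt i s n I T X ⇒ isProjective m X

def isProjectivePresentationAt (i m s n q : ℕ) (I T : Exp) : Exp :=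
  prod q (isPresentationAt i s n I T) (membersProjective i m s n I T)

def isSurjectiveAt (i m : ℕ) (I T X Y f : Exp) : Exp :=
  pi Y fun y => null m I (lam I fun a => trunc i (T ⬝ a)) (trunc i (fib i X Y f y))

def isCoverAt (i s n : ℕ) (I T X Y f : Exp) : Exp :=
  pi Y fun y => memAt i s n I T (fib i X Y f y)

/-- The type of the quadruples of a map `h : Z → X` and proofs that `p` is a cover and that the
square of `h`, `p`, `f` and `g` commutes. -/
def liftType (i s n : ℕ) (I T X C D f g Z p : Exp) : Exp :=
  sigma n (Z ⇒ X) fun h => prod n (isCoverAt i s n I T Z D p)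
    (pi Z fun z => ident i C (f ⬝ (h ⬝ z)) (g ⬝ (p ⬝ z)))

def partialChoiceType (i s n : ℕ) (I T X C D f g : Exp) : Exp :=
  trunc n (sigma n (U i) fun Z => sigma n (Z ⇒ D) fun p => liftType i s n I T X C D f g Z p)

/-- The local partial choice lemma. -/
def localPartialChoice (i j m s n q : ℕ) : Exp :=
  pi (U j) fun I => pi (I ⇒ U i) fun T =>
    isProjectivePresentationAt i m s n q I T ⇒
    pi (U i) fun X => pi (U i) fun C => pi (U i) fun D =>
    pi (X ⇒ C) fun f => pi (D ⇒ C) fun g =>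
    isProjective m D ⇒ isSurjectiveAt i m I T X C f ⇒
    partialChoiceType i s n I T X C D f g

/-! ### Terms -/

/-- The term `b` with `x : A` defined to be `a`. -/
def letIn (A a : Exp) (b : Exp → Exp) : Exp := lam A b ⬝ a

def indSigma (i k : ℕ) (A : Exp) (B : Exp → Exp) (P : Exp → Exp) (g : Exp → Exp → Exp) (p : Exp) :
    Exp :=
  const (.indSigma i k) ⬝ A ⬝ lam A B ⬝ lam (sigma i A B) P ⬝
    (lam A fun a => lam (B a) fun b => g a b) ⬝ p

def fst (i : ℕ) (A : Exp) (B : Exp → Exp) (p : Exp) : Exp :=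
  indSigma i i A B (fun _ => A) (fun a _ => a) p

def snd (i : ℕ) (A : Exp) (B : Exp → Exp) (p : Exp) : Exp :=
  indSigma i i A B (fun p => B (fst i A B p)) (fun _ b => b) p

/-- Path induction: `P x y q` from `c x : P x x refl`. -/
def indIdent (i k : ℕ) (A : Exp) (P : Exp → Exp → Exp → Exp) (c : Exp → Exp) (x y q : Exp) : Exp :=
  const (.indIdent i k) ⬝ A ⬝
    (lam A fun x => lam A fun y => lam (ident i A x y) fun q => P x y q) ⬝
    (lam A fun x => c x) ⬝ x ⬝ y ⬝ q

def truncIn (i : ℕ) (A a : Exp) : Exp := const (.truncIn i) ⬝ A ⬝ a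

def truncProp (i : ℕ) (A : Exp) : Exp := const (.truncProp i) ⬝ A

/-- The map `‖A‖ → ‖B‖` that extends `f : A → ‖B‖`. -/
def truncBind (i k : ℕ) (A B : Exp) (f : Exp → Exp) (a : Exp) : Exp :=
  const (.truncRec i k) ⬝ A ⬝ trunc k B ⬝ truncProp k B ⬝ lam A f ⬝ a

/-- The right inverse that belongs to a proof that `f : A → B` is an equivalence. -/
def equivInv (i : ℕ) : Exp :=
  lam (U i) fun A => lam (U i) fun B => lam (A ⇒ B) fun f => lam (isEquiv i A B f) fun w =>
  fst i (B ⇒ A) (fun g => isRightInv i B f g)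
    (fst i (sigma i (B ⇒ A) fun g => isRightInv i B f g)
      (fun _ => sigma i (B ⇒ A) fun g => isLeftInv i A f g) w)

/-- A function `f : A → B` with an inverse `g` and two homotopies is an equivalence. -/
def isEquivMk (i : ℕ) : Exp :=
  lam (U i) fun A => lam (U i) fun B => lam (A ⇒ B) fun f => lam (B ⇒ A) fun g =>
  lam (isRightInv i B f g) fun r => lam (isLeftInv i A f g) fun l =>
  pair i (sigma i (B ⇒ A) fun g => isRightInv i B f g)
    (fun _ => sigma i (B ⇒ A) fun g => isLeftInv i A f g)
    (pair i (B ⇒ A) (fun g => isRightInv i B f g) g r)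
    (pair i (B ⇒ A) (fun g => isLeftInv i A f g) g l)

/-- Function extensionality for non-dependent functions. -/
def funExt (i : ℕ) : Exp :=
  lam (U i) fun A => lam (U i) fun B => lam (A ⇒ B) fun f => lam (A ⇒ B) fun g =>
  equivInv i ⬝ ident i (A ⇒ B) f g ⬝ (pi A fun x => ident i B (f ⬝ x) (g ⬝ x))
    ⬝ happly i A (lam A fun _ => B) f g ⬝ (const (.funext i) ⬝ A ⬝ (lam A fun _ => B) ⬝ f ⬝ g)

/-- The identification of types in `U i` that univalence makes of a map with an inverse; `s` is the
level above `i`. -/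
def ua (s i : ℕ) : Exp :=
  lam (U i) fun A => lam (U i) fun B => lam (A ⇒ B) fun f => lam (B ⇒ A) fun g =>
  lam (isRightInv i B f g) fun r => lam (isLeftInv i A f g) fun l =>
  equivInv s ⬝ ident s (U i) A B ⬝ equiv i A B
    ⬝ (const (.indIdent s i) ⬝ U i
      ⬝ (lam (U i) fun X => lam (U i) fun Y => lam (ident s (U i) X Y) fun _ => equiv i X Y)
      ⬝ (lam (U i) fun X => idEquiv i X) ⬝ A ⬝ B)
    ⬝ (const (.univalence i) ⬝ A ⬝ B)
    ⬝ pair i (A ⇒ B) (fun f => isEquiv i A B f) f (isEquivMk i ⬝ A ⬝ B ⬝ f ⬝ g ⬝ r ⬝ l)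

/-! ### Presentations -/

section Presentation

variable (i m s n : ℕ) (I T : Exp)

/-- `X` is in the collection, by an identification of `T a` with `X`. -/
def memIn (X a p : Exp) : Exp :=
  truncIn n (sigma n I fun a => ident s (U i) (T ⬝ a) X)
    (pair n I (fun a => ident s (U i) (T ⬝ a) X) a p)

def memSelf (a : Exp) : Exp :=
  memIn i s n I T (T ⬝ a) a (refl s (U i) (T ⬝ a))

/-- A partial element of `F` is a function from a member of the collection to `F`. -/
def partialElt (F : Exp) : Exp := sigma m I fun a => (T ⬝ a) ⇒ F

/-- Mere existence of a partial element of `F`. -/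
def hasPartial (F : Exp) : Exp := trunc m (partialElt m I T F)

def ofMemType : Exp :=
  pi (U i) fun F => pi (U i) fun X => memAt i s n I T X ⇒ (X ⇒ F) ⇒ hasPartial m I T F

/-- A function from a type in the collection to `F` gives a partial element of `F`. -/
def ofMem : Exp :=
  lam (U i) fun F => lam (U i) fun X => lam (memAt i s n I T X) fun x => lam (X ⇒ F) fun f =>
  truncBind n m (sigma n I fun a => ident s (U i) (T ⬝ a) X) (partialElt m I T F)
    (fun c => indSigma n m I (fun a => ident s (U i) (T ⬝ a) X) (fun _ => hasPartial m I T F)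
      (fun a p => truncIn m (partialElt m I T F) (pair m I (fun a => (T ⬝ a) ⇒ F) a
        -- Transport along `T a = X` acts contravariantly and turns a map `X → F` into a map `T a →
        -- F`.
        (indIdent s i (U i) (fun X Y _ => (Y ⇒ F) ⇒ X ⇒ F) (fun X => lam (X ⇒ F) fun k => k)
          (T ⬝ a) X p ⬝ f))) c) x

/-- This is all that nullness of `hasPartial` requires; the homotopies are automatic for a
proposition. -/
def glueType : Exp :=
  pi (U i) fun F => pi I fun a => (trunc i (T ⬝ a) ⇒ hasPartial m I T F) ⇒ hasPartial m I T F

/-- Closure of the collection under sums glues functions `T (b x) → F` for `x : T a`. -/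
def glueFamily (ofMem memSigma F a : Exp) : Exp :=
  lam ((T ⬝ a) ⇒ I) fun b => lam (pi (T ⬝ a) fun x => (T ⬝ (b ⬝ x)) ⇒ F) fun k =>
    let B := lam (T ⬝ a) fun x => T ⬝ (b ⬝ x)
    ofMem ⬝ F ⬝ (sigma i (T ⬝ a) fun x => B ⬝ x)
      ⬝ (memSigma ⬝ (T ⬝ a) ⬝ B ⬝ memSelf i s n I T a
        ⬝ (lam (T ⬝ a) fun x => memSelf i s n I T (b ⬝ x)))
      ⬝ (lam (sigma i (T ⬝ a) fun x => B ⬝ x) fun y =>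
        indSigma i i (T ⬝ a) (fun x => B ⬝ x) (fun _ => F) (fun x t => k ⬝ x ⬝ t) y)

/-- A family of partial elements over `T a` gives a partial element, by projectivity of `T a`. -/
def glue (ofMem memSigma proj : Exp) : Exp :=
  lam (U i) fun F => lam I fun a => lam (trunc i (T ⬝ a) ⇒ hasPartial m I T F) fun u =>
  truncBind m m ((T ⬝ a) ⇒ partialElt m I T F) (partialElt m I T F)
    (fun v => glueFamily i s n I T ofMem memSigma F a
      ⬝ (lam (T ⬝ a) fun x => fst m I (fun a => (T ⬝ a) ⇒ F) (v ⬝ x))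
      ⬝ (lam (T ⬝ a) fun x => snd m I (fun a => (T ⬝ a) ⇒ F) (v ⬝ x)))
    -- The chosen values include indices in `I : U j`, so projectivity is needed for families at
    -- level `max i j`.
    (proj ⬝ (T ⬝ a) ⬝ memSelf i s n I T a ⬝ (lam (T ⬝ a) fun _ => partialElt m I T F)
      ⬝ (lam (T ⬝ a) fun x => u ⬝ truncIn i (T ⬝ a) x))

def ofSheafType : Exp :=
  pi (U i) fun F => null m I (lam I fun a => trunc i (T ⬝ a)) (trunc i F) ⇒ hasPartial m I T F

/-- Mere existence of a partial element is null at the truncations of the members. -/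
def hasPartialIsNull (glue F : Exp) : Exp :=
  let Q := hasPartial m I T F
  let B := lam I fun a => trunc i (T ⬝ a)
  lam I fun a => isEquivMk m ⬝ Q ⬝ ((B ⬝ a) ⇒ Q) ⬝ (lam Q fun y => lam (B ⬝ a) fun _ => y)
    ⬝ (glue ⬝ F ⬝ a)
    -- Both homotopies hold because `Q` is a proposition. This one compares functions, hence the use
    -- of function extensionality.
    ⬝ (lam ((B ⬝ a) ⇒ Q) fun u => funExt m ⬝ (B ⬝ a) ⬝ Q ⬝ (lam (B ⬝ a) fun _ => glue ⬝ F ⬝ a ⬝ u)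
      ⬝ u ⬝ (lam (B ⬝ a) fun x => truncProp m (partialElt m I T F) ⬝ (glue ⬝ F ⬝ a ⬝ u) ⬝ (u ⬝ x)))
    ⬝ (lam Q fun y => truncProp m (partialElt m I T F)
      ⬝ (glue ⬝ F ⬝ a ⬝ (lam (B ⬝ a) fun _ => y)) ⬝ y)

/-- An element of the sheafification of `‖F‖` gives a partial element of `F`. -/
def ofSheaf (ofMem memUnit glue : Exp) : Exp :=
  lam (U i) fun F =>
  let Q := hasPartial m I T F
  let B := lam I fun a => trunc i (T ⬝ a)
  equivInv m ⬝ (null m I B (trunc i F) ⇒ Q) ⬝ (trunc i F ⇒ Q)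
    ⬝ (lam (null m I B (trunc i F) ⇒ Q) fun g => lam (trunc i F) fun x =>
      g ⬝ (const (.nullUnit m) ⬝ I ⬝ B ⬝ trunc i F ⬝ x))
    ⬝ (const (.nullRec m m) ⬝ I ⬝ B ⬝ trunc i F ⬝ Q ⬝ hasPartialIsNull i m I T glue F)
    ⬝ (lam (trunc i F) fun y => truncBind i m F (partialElt m I T F)
        -- An element of `F` is a partial element defined on `1`, which is in the collection.
        (fun z => ofMem ⬝ F ⬝ unit ⬝ memUnit ⬝ (lam unit fun _ => z)) y)

end Presentation

/-! ### The total space of a family `P : D → U i` and its projection -/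

section Projection

variable (i : ℕ) (D P : Exp)

def total : Exp := sigma i D fun x => P ⬝ x

def proj : Exp := lam (total i D P) fun z => fst i D (fun x => P ⬝ x) z

def fibProj (d : Exp) : Exp := fib i (total i D P) D (proj i D P) d

def fibPair (d x t q : Exp) : Exp :=
  pair i (total i D P) (fun z => ident i D (proj i D P ⬝ z) d) (pair i D (fun x => P ⬝ x) x t) q

/-- To give an element of `R` over each point of a fibre, give it over `((x, t), q)`. -/
def fibElim (d : Exp) (R : Exp → Exp) (g : Exp → Exp → Exp → Exp) (y : Exp) : Exp :=
  indSigma i i (total i D P) (fun z => ident i D (proj i D P ⬝ z) d) R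
    (fun z q => indSigma i i D (fun x => P ⬝ x)
      -- The path is generalized because its type depends on `z`; at a pair `(x, t)` the projection
      -- computes to `x`.
      (fun z => pi (ident i D (proj i D P ⬝ z) d) fun q =>
        R (pair i (total i D P) (fun z => ident i D (proj i D P ⬝ z) d) z q))
      (fun x t => lam (ident i D x d) fun q => g x t q) z ⬝ q) y

/-- The inverse of `toFib`, by transport along the path of a point of the fibre. -/
def ofFib : Exp :=
  lam D fun d => lam (fibProj i D P d) fun y =>
    indSigma i i (total i D P) (fun z => ident i D (proj i D P ⬝ z) d) (fun _ => P ⬝ d)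
      (fun z q => indIdent i i D (fun x y _ => (P ⬝ x) ⇒ (P ⬝ y)) (fun x => lam (P ⬝ x) fun t => t)
        (fst i D (fun x => P ⬝ x) z) d q ⬝ snd i D (fun x => P ⬝ x) z) y

def toFib (d : Exp) : Exp := lam (P ⬝ d) fun t => fibPair i D P d d t (refl i D d)

def fibFam : Exp := lam D fun d => fibProj i D P d

def toFibFam : Exp := lam D fun d => toFib i D P d

/-- Induction for a family `F` over `D` with functions `e d : P d → F d`. -/
def indType (F e : Exp) : Exp :=
  pi (pi D fun d => (F ⬝ d) ⇒ U i) fun R =>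
  (pi D fun x => pi (P ⬝ x) fun t => R ⬝ x ⬝ (e ⬝ x ⬝ t)) ⇒
  pi D fun d => pi (F ⬝ d) fun y => R ⬝ d ⬝ y

/-- The fibres of the projection satisfy induction. -/
def fibInd : Exp :=
  lam (pi D fun d => (fibFam i D P ⬝ d) ⇒ U i) fun R =>
  lam (pi D fun x => pi (P ⬝ x) fun t => R ⬝ x ⬝ (toFibFam i D P ⬝ x ⬝ t)) fun g =>
  lam D fun d => lam (fibFam i D P ⬝ d) fun y => fibElim i D P d (fun y => R ⬝ d ⬝ y)
    -- Path induction reduces to reflexivity, where the point of the fibre is `toFib x t`. The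
    -- motive quantifies over `t` because its type varies with `x`.
    (fun x t q => indIdent i i D
      (fun x d q => pi (P ⬝ x) fun t => R ⬝ d ⬝ fibPair i D P d x t q)
      (fun x => g ⬝ x) x d q ⬝ t) y

/-- From induction for `F` and `e`, and left inverses `o d` of `e d`, identifications of `P d` with
`F d`. -/
def uaOfInd (s : ℕ) : Exp :=
  lam (D ⇒ U i) fun F => lam (pi D fun d => (P ⬝ d) ⇒ (F ⬝ d)) fun e =>
  lam (indType i D P F e) fun ind => lam (pi D fun d => (F ⬝ d) ⇒ (P ⬝ d)) fun o =>
  lam (pi D fun d => isLeftInv i (P ⬝ d) (e ⬝ d) (o ⬝ d)) fun l =>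
  -- By induction only the points `e x t` matter, and there the claim is the left inverse law with
  -- `e x` applied to it.
  letIn (pi D fun d => isRightInv i (F ⬝ d) (e ⬝ d) (o ⬝ d))
    (ind ⬝ (lam D fun d => lam (F ⬝ d) fun y => ident i (F ⬝ d) (e ⬝ d ⬝ (o ⬝ d ⬝ y)) y)
      ⬝ (lam D fun x => lam (P ⬝ x) fun t => indIdent i i (P ⬝ x)
        (fun t t' _ => ident i (F ⬝ x) (e ⬝ x ⬝ t) (e ⬝ x ⬝ t'))
        (fun t => refl i (F ⬝ x) (e ⬝ x ⬝ t)) (o ⬝ x ⬝ (e ⬝ x ⬝ t)) t (l ⬝ x ⬝ t))) fun r =>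
  lam D fun d => ua s i ⬝ (P ⬝ d) ⬝ (F ⬝ d) ⬝ (e ⬝ d) ⬝ (o ⬝ d) ⬝ (r ⬝ d) ⬝ (l ⬝ d)

end Projection

/-- The identification of `P d` with the fibre of the projection over `d`. -/
def fibProjUa (s i : ℕ) : Exp :=
  lam (U i) fun D => lam (D ⇒ U i) fun P =>
  uaOfInd i D P s ⬝ fibFam i D P ⬝ toFibFam i D P ⬝ fibInd i D P ⬝ ofFib i D P
    -- On `toFib d t` the transport is along reflexivity, so `ofFib` returns `t` by computation.
    ⬝ (lam D fun d => lam (P ⬝ d) fun t => refl i (P ⬝ d) t)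

/-! ### The proof -/

def partialChoiceMk (i s n : ℕ) (I T X C D f g : Exp) : Exp :=
  lam (U i) fun Z => lam (Z ⇒ D) fun p => lam (Z ⇒ X) fun h =>
  lam (isCoverAt i s n I T Z D p) fun cover =>
  lam (pi Z fun z => ident i C (f ⬝ (h ⬝ z)) (g ⬝ (p ⬝ z))) fun square =>
  truncIn n (sigma n (U i) fun Z => sigma n (Z ⇒ D) fun p => liftType i s n I T X C D f g Z p)
    (pair n (U i) (fun Z => sigma n (Z ⇒ D) fun p => liftType i s n I T X C D f g Z p) Z
      (pair n (Z ⇒ D) (fun p => liftType i s n I T X C D f g Z p) p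
        (pair n (Z ⇒ X) (fun h => prod n (isCoverAt i s n I T Z D p)
            (pi Z fun z => ident i C (f ⬝ (h ⬝ z)) (g ⬝ (p ⬝ z)))) h
          (pair n (isCoverAt i s n I T Z D p)
            (fun _ => pi Z fun z => ident i C (f ⬝ (h ⬝ z)) (g ⬝ (p ⬝ z))) cover square))))

/-- The lift of `g` from a choice of `a d : I` and `v d : T (a d) → fib f (g d)`, for `d : D`. -/
def lift (i s n : ℕ) (I T X C D f g : Exp) : Exp :=
  lam (D ⇒ I) fun a => lam (pi D fun d => (T ⬝ (a ⬝ d)) ⇒ fib i X C f (g ⬝ d)) fun v =>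
  let P := lam D fun d => T ⬝ (a ⬝ d)
  let Z := total i D P
  let p := proj i D P
  let F := fun d => fun x => ident i C (f ⬝ x) (g ⬝ d)
  let h := lam Z fun z => indSigma i i D (fun d => P ⬝ d) (fun _ => X)
    (fun d t => fst i X (F d) (v ⬝ d ⬝ t)) z
  partialChoiceMk i s n I T X C D f g ⬝ Z ⬝ p ⬝ h
    ⬝ (lam D fun d => memIn i s n I T (fib i Z D p d) (a ⬝ d) (fibProjUa s i ⬝ D ⬝ P ⬝ d))
    -- At a pair `(d, t)` both `h` and `p` compute, which leaves the path component of `v d t`.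
    ⬝ (lam Z fun z => indSigma i i D (fun d => P ⬝ d)
        (fun z => ident i C (f ⬝ (h ⬝ z)) (g ⬝ (p ⬝ z)))
        (fun d t => snd i X (F d) (v ⬝ d ⬝ t)) z)

/-- The proof of the local partial choice lemma: `projD` chooses for every `d : D` a partial element of
the fibre of `f` over `g d`. -/
def localPartialChoiceProof (i j m s n q : ℕ) : Exp :=
  lam (U j) fun I => lam (I ⇒ U i) fun T =>
  lam (isProjectivePresentationAt i m s n q I T) fun w =>
  letIn (isPresentationAt i s n I T)
    (fst q (isPresentationAt i s n I T) (fun _ => membersProjective i m s n I T) w) fun pres =>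
  letIn (membersProjective i m s n I T)
    (snd q (isPresentationAt i s n I T) (fun _ => membersProjective i m s n I T) w) fun proj =>
  letIn (memAt i s n I T unit)
    (fst n (memAt i s n I T unit) (fun _ => sigmaClosed i s n I T) pres) fun memUnit =>
  letIn (sigmaClosed i s n I T)
    (snd n (memAt i s n I T unit) (fun _ => sigmaClosed i s n I T) pres) fun memSigma =>
  letIn (ofMemType i m s n I T) (ofMem i m s n I T) fun ofMem =>
  letIn (glueType i m I T) (glue i m s n I T ofMem memSigma proj) fun glue =>
  letIn (ofSheafType i m I T) (ofSheaf i m I T ofMem memUnit glue) fun ofSheaf =>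
  lam (U i) fun X => lam (U i) fun C => lam (U i) fun D =>
  lam (X ⇒ C) fun f => lam (D ⇒ C) fun g =>
  lam (isProjective m D) fun projD => lam (isSurjectiveAt i m I T X C f) fun surj =>
  let F := fun d => fib i X C f (g ⬝ d)
  truncBind m n (pi D fun d => partialElt m I T (F d))
    (sigma n (U i) fun Z => sigma n (Z ⇒ D) fun p => liftType i s n I T X C D f g Z p)
    (fun σ => lift i s n I T X C D f g
      ⬝ (lam D fun d => fst m I (fun a => (T ⬝ a) ⇒ F d) (σ ⬝ d))
      ⬝ (lam D fun d => snd m I (fun a => (T ⬝ a) ⇒ F d) (σ ⬝ d)))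
    (projD ⬝ (lam D fun d => partialElt m I T (F d))
      ⬝ lam D fun d => ofSheaf ⬝ F d ⬝ (surj ⬝ (g ⬝ d)))

/-- The numeral `18 = 2 + 8 * 2` is read as `max (i + 1) (j + 1)`, the only one of the six levels
that does not have its intended form by computation. -/
theorem level_eighteen (i j : ℕ) : level i j 18 = max i j + 1 := Nat.add_max_add_right i j 1

set_option maxRecDepth 100000 in
/-- The numerals stand for the levels `i`, `j`, `max i j`, `i + 1`, `max (i + 1) j`, `max i j + 1`. -/
theorem check_localPartialChoiceProof :
    (Checker.ofDepth 200).check [] (close (localPartialChoiceProof 1 8 9 2 10 18))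
      (close (localPartialChoice 1 8 9 2 10 18)) = true := by
  decide +kernel

end HoTT

open HoTT
theorem mainTheorem4 (i j : ℕ) :
    HoTT.IsTheorem
      (HoTT.pi (U j) fun I => HoTT.pi (I ⇒ U i) fun T =>
        isProjectivePresentation i j I T ⇒
        HoTT.pi (U i) fun X => HoTT.pi (U i) fun C => HoTT.pi (U i) fun D =>
        HoTT.pi (X ⇒ C) fun f => HoTT.pi (D ⇒ C) fun g =>
        isProjective (max i j) D ⇒
        isSurjective i j I T X C f ⇒
        HoTT.trunc (max (i + 1) j)
          (HoTT.sigma (max (i + 1) j) (U i) fun Z =>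
            HoTT.sigma (max (i + 1) j) (Z ⇒ D) fun p =>
            HoTT.sigma (max (i + 1) j) (Z ⇒ X) fun h =>
              HoTT.prod (max (i + 1) j) (isCover i j I T Z D p)
                (HoTT.pi Z fun z => HoTT.ident i C (f ⬝ (h ⬝ z)) (g ⬝ (p ⬝ z))))) := by
  have h := Checker.derivable_of_check i j check_localPartialChoiceProof
  -- The type is built uniformly in its levels, so relabelling it computes to the same type at the
  -- actual levels.
  have e : (close (localPartialChoice 1 8 9 2 10 18)).relabel (level i j) =
      close (localPartialChoice i j (max i j) (i + 1) (max (i + 1) j) (level i j 18)) := rfl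
  rw [e, level_eighteen] at h
  exact ⟨_, h⟩
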